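/- Let $\mathcal{P}$ be a finite polysquare translation surface, that is, the quotient of a disjoint union of finitely many closed unit squares $[0,1]^2$ obtained by gluing, by translations, the right edge of every square to the left edge of some square and the top edge of every square to the bottom edge of some square, every edge being used exactly once (the surface need not be connected). Let $\mathcal{M}=\mathcal{P}\times[0,1)$ be the cartesian product of $\mathcal{P}$ with the unit torus $[0,1)=\mathbb{R}/\mathbb{Z}$. Equip $\mathcal{P}$ and $\mathcal{M}$ with the $2$- and $3$-dimensional Lebesgue measures. Call a vector in $\mathbb{R}^n$ a Kronecker direction if its $n$ coordinates are linearly independent over $\mathbb{Q}$. Let $\mathbf{v}=(v_1,v_2)\in\mathbb{R}^2$ be a Kronecker direction. Then the following statements are equivalent: (i) The geodesic flow with direction $\mathbf{v}$ on $\mathcal{P}$ is ergodic. (ii) For every $w\in\mathbb{R}$ such that $(\mathbf{v},w)=(v_1,v_2,w)\in\mathbb{R}^3$ is a Kronecker direction, the geodesic flow with direction $(\mathbf{v},w)$ in $\mathcal{M}$ is ergodic. Here the geodesics are the bi-infinite straight motions on $\mathcal{P}$ (with constant velocity $\mathbf{v}$) that never hit a singularity (a vertex with cone angle different from $2\pi$),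 respectively the motions in $\mathcal{M}$ with constant velocity $(\mathbf{v},w)$ whose projections to $\mathcal{P}$ are of this kind; they start from almost every point. The flow is called ergodic if every measurable set $A$ such that each of these geodesics lies either entirely inside or entirely outside $A$ has measure zero or a complement of measure zero. -/

import Mathlib

open MeasureTheory

noncomputable section

/-- A vector `(v₁, …, vₙ)` is a Kronecker direction if its coordinates are linearly independent
over `ℚ`; for a vector normalised as `(a₁, …, a_d, 1)` this says that `a₁, …, a_d, 1` are linearly
independent over `ℚ`, and the property does not change when the vector is rescaled. -/
def IsKroneckerDirection {n : ℕ} (v : Fin n → ℝ) : Prop :=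
  LinearIndependent ℚ v

/-- The closed unit square `[0,1]²`, as a subset of the plane. -/
abbrev UnitSquare : Type := Set.Icc (0 : Fin 2 → ℝ) 1

/-- Gluing data of a polysquare translation surface with atomic squares indexed by `ι`: the right
edge of the square `σ` is glued by translation to the left edge of the square `right σ`, and the top
edge of `σ` is glued by translation to the bottom edge of `up σ`. -/
structure PolysquareSurface (ι : Type*) where
  right : Equiv.Perm ι
  up : Equiv.Perm ι

namespace PolysquareSurface

variable {ι : Type*} (P : PolysquareSurface ι)

/-- The identifications of edges. -/
inductive Glue : (Σ _ : ι, UnitSquare) → (Σ _ : ι, UnitSquare) → Prop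
  | right (σ : ι) (p q : UnitSquare) (hp : p.1 0 = 1) (hq : q.1 0 = 0) (h : p.1 1 = q.1 1) :
      Glue ⟨σ, p⟩ ⟨P.right σ, q⟩
  | up (σ : ι) (p q : UnitSquare) (hp : p.1 1 = 1) (hq : q.1 1 = 0) (h : p.1 0 = q.1 0) :
      Glue ⟨σ, p⟩ ⟨P.up σ, q⟩

/-- The surface itself: the disjoint union of the closed atomic squares modulo the identifications
of their edges. -/
def Point : Type _ := Quot P.Glue

/-- A set of points of the surface is measurable if and only if its trace on every atomic square is
a measurable set. -/
instance : MeasurableSpace P.Point :=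
  inferInstanceAs (MeasurableSpace (Quot P.Glue))

/-- The point of the surface represented by the point `p` of the atomic square `σ`. -/
def toPoint (σ : ι) (p : UnitSquare) : P.Point := Quot.mk P.Glue ⟨σ, p⟩

/-- The area measure of the surface: two-dimensional Lebesgue measure on every atomic square. -/
def area [Fintype ι] : Measure P.Point :=
  ∑ σ : ι, Measure.map (P.toPoint σ) (Measure.comap Subtype.val volume)

/-- The singularities, that is, the vertices whose cone angle is not `2π`. Every vertex is the
upper right corner of some square `σ`, and its angle is `2π` precisely when the squares
`σ`, `right σ`, `up σ` and `up (right σ) = right (up σ)` close up around it. -/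
def IsSingular (x : P.Point) : Prop :=
  ∃ (σ : ι) (p : UnitSquare), p.1 = 1 ∧ P.right (P.up σ) ≠ P.up (P.right σ) ∧ x = P.toPoint σ p

/-- `L` is a (bi-infinite) geodesic with direction `v`, run through with velocity `v`: it never
hits a singularity, and just after and just before every time `t` it is a straight motion with
velocity `v` in some closed atomic square. At a nonsingular point there is exactly one way to leave
and one way to arrive with a given velocity, so such a curve goes straight on across edges. -/
def IsGeodesic (v : Fin 2 → ℝ) (L : ℝ → P.Point) : Prop :=
  ∀ t : ℝ, ¬ P.IsSingular (L t) ∧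
    (∃ ε > 0, ∃ (σ : ι) (p : Fin 2 → ℝ), ∀ h ∈ Set.Icc 0 ε,
      ∃ hp : p + h • v ∈ Set.Icc (0 : Fin 2 → ℝ) 1, L (t + h) = P.toPoint σ ⟨p + h • v, hp⟩) ∧
    (∃ ε > 0, ∃ (σ : ι) (p : Fin 2 → ℝ), ∀ h ∈ Set.Icc 0 ε,
      ∃ hp : p - h • v ∈ Set.Icc (0 : Fin 2 → ℝ) 1, L (t - h) = P.toPoint σ ⟨p - h • v, hp⟩)

/-- The polycube translation `3`-manifold `P × [0,1)`, where `[0,1)` is the unit torus `ℝ/ℤ`. -/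
abbrev Manifold3 : Type _ := P.Point × UnitAddCircle

/-- Three-dimensional Lebesgue measure on `P × [0,1)`. -/
def volume3 [Fintype ι] : Measure P.Manifold3 :=
  P.area.prod (volume : Measure UnitAddCircle)

/-- Geodesics with direction `u = (u₁, u₂, u₃)` in the flat product `P × [0,1)`: the first
component is a geodesic with direction `(u₁, u₂)` on the surface and the second one moves along the
unit torus with velocity `u₃`. -/
def IsGeodesic3 (u : Fin 3 → ℝ) (L : ℝ → P.Manifold3) : Prop :=
  P.IsGeodesic ![u 0, u 1] (fun t => (L t).1) ∧
    ∀ t : ℝ, (L t).2 = (L 0).2 + ((t * u 2 : ℝ) : UnitAddCircle)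

end PolysquareSurface

/-- Ergodicity, with respect to `μ`, of the flow whose orbits are the given parametrised curves:
every measurable set that is invariant, in the sense that each orbit that meets it stays in it for
all (past and future) time, is null or has null complement. -/
def IsErgodicFlow {X : Type*} [MeasurableSpace X] (μ : Measure X) (IsOrbit : (ℝ → X) → Prop) :
    Prop :=
  ∀ A : Set X, MeasurableSet A → (∀ L, IsOrbit L → ∀ s t : ℝ, L s ∈ A ↔ L t ∈ A) →
    μ A = 0 ∨ μ Aᶜ = 0

namespace PolysquareSurface

variable {ι : Type*} [Fintype ι] (P : PolysquareSurface ι)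

/-- The geodesic flow with direction `v` on the surface is ergodic. -/
def GeodesicFlowErgodic (v : Fin 2 → ℝ) : Prop :=
  IsErgodicFlow P.area (P.IsGeodesic v)

/-- The geodesic flow with direction `u` on `P × [0,1)` is ergodic. -/
def GeodesicFlowErgodic3 (u : Fin 3 → ℝ) : Prop :=
  IsErgodicFlow P.volume3 (P.IsGeodesic3 u)

end PolysquareSurface

end

open MeasureTheory

noncomputable section

/-! For (i) ⇒ (ii), let `A` be invariant in the product and expand the indicators of its circle
sections in Fourier series. Along a geodesic of the surface the `n`-th coefficient `c n` satisfies
`c n (L t) = e(-n w t) c n (L 0)`, where `e(s) = exp(2πis)`. So its zero set is invariant, and by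
(i) `c n` is a.e. zero or a.e. nonzero.

The second case is impossible for `n ≠ 0` (`not_ae_ne_zero_of_eigenfunction`). The surface covers
the torus with one sheet per square, and the flow permutes the sheets. Hence the product of `c n`
over a fibre is an eigenfunction of the linear flow with direction `(|v 0|, |v 1|)`, of frequency
`-n w` times the number of squares. Independence over `ℚ` keeps this number outside `ℤ|v 0| + ℤ|v
1|`, so the product vanishes a.e. (`ae_eq_zero_of_torus_eigenfunction`), although its factors do
not. A product is used because a sum over the fibre could cancel.

Thus almost every section is null or conull, and (i) applied to the set of points with null section
finishes. For (ii) ⇒ (i), pick any admissible `w` and test on cylinders. -/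

/-! ### Uniqueness of Fourier coefficients on the circle and the torus -/

theorem unitAddCircle_volume_eq_haarAddCircle :
    (volume : Measure UnitAddCircle) = AddCircle.haarAddCircle := by
  simpa using AddCircle.volume_eq_smul_haarAddCircle (T := (1 : ℝ))

/-- Normalised Haar measure on the two-dimensional torus. -/
def torusMeasure : Measure (UnitAddTorus (Fin 2)) :=
  Measure.pi fun _ => AddCircle.haarAddCircle

instance : IsProbabilityMeasure torusMeasure := by
  unfold torusMeasure; infer_instance

instance : torusMeasure.IsAddRightInvariant := by
  unfold torusMeasure; infer_instance

theorem ae_eq_zero_of_mFourier_integral_eq_zero {F : UnitAddTorus (Fin 2) → ℂ}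
    (hF : MemLp F 2 torusMeasure)
    (h : ∀ m : Fin 2 → ℤ, ∫ a, UnitAddTorus.mFourier (-m) a * F a ∂torusMeasure = 0) :
    F =ᵐ[torusMeasure] 0 := by
  have hz : hF.toLp F = 0 := by
    refine (LinearIsometryEquiv.map_eq_zero_iff (UnitAddTorus.mFourierBasis (d := Fin 2)).repr).1 ?_
    ext m
    refine (UnitAddTorus.mFourierBasis_repr _ _).trans ?_
    refine Eq.trans (integral_congr_ae (μ := torusMeasure) ?_) (h m)
    filter_upwards [hF.coeFn_toLp] with a ha
    exact congrArg (UnitAddTorus.mFourier (-m) a * ·) ha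
  exact hF.coeFn_toLp.symm.trans (hz ▸ Lp.coeFn_zero _ _ _)

theorem ae_eq_zero_of_fourierCoeff_eq_zero {f : UnitAddCircle → ℂ}
    (hf : MemLp f 2 AddCircle.haarAddCircle) (h : ∀ n : ℤ, fourierCoeff f n = 0) :
    f =ᵐ[AddCircle.haarAddCircle] 0 := by
  have hz : hf.toLp f = 0 := by
    refine (fourierBasis (T := 1)).repr.injective ?_
    rw [map_zero]
    ext m
    rw [fourierBasis_repr, fourierCoeff_congr_ae hf.coeFn_toLp, h]
    rfl
  exact hf.coeFn_toLp.symm.trans (hz ▸ Lp.coeFn_zero _ _ _)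

/-- Subtracting the mean `fourierCoeff f 0` leaves a function all of whose coefficients vanish. -/
theorem ae_eq_const_of_fourierCoeff_eq_zero {f : UnitAddCircle → ℂ}
    (hf : MemLp f 2 AddCircle.haarAddCircle) (h : ∀ n : ℤ, n ≠ 0 → fourierCoeff f n = 0) :
    ∃ c : ℂ, f =ᵐ[AddCircle.haarAddCircle] fun _ => c := by
  refine ⟨fourierCoeff f 0, ?_⟩
  have hc : MemLp (fun _ : UnitAddCircle => fourierCoeff f 0) 2 AddCircle.haarAddCircle :=
    memLp_const _
  have key := ae_eq_zero_of_fourierCoeff_eq_zero (hf.sub hc) fun n => ?_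
  · filter_upwards [key] with y hy
    simpa [sub_eq_zero] using hy
  · have hcn : fourierCoeff (fun _ : UnitAddCircle => fourierCoeff f 0) n
        = fourierCoeff f 0 * (Pi.single (0 : ℤ) (1 : ℂ) : ℤ → ℂ) n := by
      rw [← fourierCoeff_fourier (T := 1) 0, ← fourierCoeff.const_mul]
      simp
    have hsub : fourierCoeff (f - fun _ : UnitAddCircle => fourierCoeff f 0) n
        = fourierCoeff f n - fourierCoeff (fun _ : UnitAddCircle => fourierCoeff f 0) n := by
      have h1 := (hf.integrable one_le_two).fourier_smul (-n)
      have h2 := (hc.integrable one_le_two).fourier_smul (-n)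
      simp only [fourierCoeff, Pi.sub_apply, smul_sub] at h1 h2 ⊢
      exact integral_sub h1 h2
    rw [hsub, hcn]
    rcases eq_or_ne n 0 with rfl | hn
    · simp
    · simp [h n hn, hn]

/-! ### Coordinates of the torus in the unit square -/

/-- The representative in `[0,1)²` of a point of the torus. -/
def torusRep (a : UnitAddTorus (Fin 2)) : Fin 2 → ℝ :=
  fun i => (AddCircle.equivIco (1 : ℝ) 0 (a i) : ℝ)

theorem coe_torusRep (a : UnitAddTorus (Fin 2)) (i : Fin 2) :
    ((torusRep a i : ℝ) : UnitAddCircle) = a i :=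
  AddCircle.coe_equivIco

theorem torusRep_coe (p : Fin 2 → ℝ) :
    torusRep (fun i => ((p i : ℝ) : UnitAddCircle)) = fun i => Int.fract (p i) := by
  funext i
  have := AddCircle.coe_equivIco_mk_apply (p := (1 : ℝ)) (p i)
  simp only [div_one, mul_one] at this
  exact this

theorem torusRep_mem (a : UnitAddTorus (Fin 2)) (i : Fin 2) : torusRep a i ∈ Set.Ico (0 : ℝ) 1 := by
  have := (AddCircle.equivIco (1 : ℝ) 0 (a i)).2
  exact ⟨this.1, this.2.trans_eq (zero_add 1)⟩

theorem measurable_equivIco :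
    Measurable fun a : UnitAddCircle => (AddCircle.equivIco (1 : ℝ) 0 a : ℝ) :=
  measurable_subtype_coe.comp (AddCircle.measurableEquivIco (1 : ℝ) 0).measurable

theorem measurePreserving_equivIco :
    MeasurePreserving (fun a : UnitAddCircle => (AddCircle.equivIco (1 : ℝ) 0 a : ℝ))
      AddCircle.haarAddCircle (volume.restrict (Set.Ioc (0 : ℝ) 1)) := by
  refine ⟨measurable_equivIco, ?_⟩
  have h := UnitAddCircle.measurePreserving_mk 0
  rw [unitAddCircle_volume_eq_haarAddCircle, zero_add] at h
  rw [← h.map_eq, Measure.map_map measurable_equivIco h.measurable]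
  conv_rhs => rw [← Measure.map_id (μ := volume.restrict (Set.Ioc (0 : ℝ) 1))]
  refine Measure.map_congr ?_
  rw [Filter.EventuallyEq, ae_restrict_iff' measurableSet_Ioc]
  -- Representatives lie in `[0,1)` but the measure lives on `(0,1]`; only the null point `1` is
  -- moved.
  filter_upwards [compl_mem_ae_iff.2 (measure_singleton (μ := volume) (1 : ℝ))] with x hx hx'
  have := AddCircle.coe_equivIco_mk_apply (p := (1 : ℝ)) x
  simp only [div_one, mul_one] at this
  exact this.trans (Int.fract_eq_self.2 ⟨hx'.1.le, lt_of_le_of_ne hx'.2 hx⟩)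

theorem measurable_torusRep : Measurable torusRep :=
  measurable_pi_lambda _ fun i => measurable_equivIco.comp (measurable_pi_apply i)

theorem ae_torusRep {p : (Fin 2 → ℝ) → Prop} (h : ∀ᵐ x, p x) :
    ∀ᵐ a ∂torusMeasure, p (torusRep a) := by
  have hmp : MeasurePreserving torusRep torusMeasure
      (Measure.pi fun _ => volume.restrict (Set.Ioc (0 : ℝ) 1)) :=
    measurePreserving_pi _ _ fun _ => measurePreserving_equivIco
  refine hmp.quasiMeasurePreserving.ae ?_
  rw [← Measure.restrict_pi_pi, ← volume_pi]
  exact ae_restrict_of_ae h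

/-! ### Monodromy along a line in the square grid -/

/-- The recursion can also be run backwards from `0` because every `a k` is invertible. -/
theorem exists_int_recursion {G : Type*} [Group G] (a : ℤ → G) :
    ∃ g : ℤ → G, ∀ k, g k = a k * g (k - 1) := by
  let pos : ℕ → G := fun n => Nat.rec 1 (fun n x => a (n + 1) * x) n
  let neg : ℕ → G := fun n => Nat.rec 1 (fun n x => (a (-n))⁻¹ * x) n
  refine ⟨fun k => if 0 ≤ k then pos k.toNat else neg (-k).toNat, fun k => ?_⟩
  rcases lt_trichotomy k 0 with hk | rfl | hk
  · obtain ⟨n, rfl⟩ : ∃ n : ℕ, k = -(n + 1) := ⟨(-k - 1).toNat, by omega⟩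
    have h1 : ¬ (0 : ℤ) ≤ -(n + 1) := by omega
    have h2 : ¬ (0 : ℤ) ≤ -(n + 1) - 1 := by omega
    have h3 : (-(-((n : ℤ) + 1) - 1)).toNat = (n + 1) + 1 := by omega
    have h4 : (-(-((n : ℤ) + 1))).toNat = n + 1 := by omega
    simp only [h1, h2, if_false, h3, h4]
    change neg (n + 1) = _ * ((a (-((n + 1 : ℕ) : ℤ)))⁻¹ * neg (n + 1))
    push_cast
    simp
  · simp [pos, neg]
  · obtain ⟨n, rfl⟩ : ∃ n : ℕ, k = n + 1 := ⟨(k - 1).toNat, by omega⟩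
    have h1 : (0 : ℤ) ≤ n + 1 := by omega
    have h3 : ((n : ℤ) + 1).toNat = n + 1 := by omega
    simp only [h1, if_true, h3, add_sub_cancel_right, Int.natCast_nonneg, Int.toNat_natCast]
    rfl

/-- Along a line that avoids the integer lattice, the unit cells are numbered consecutively by the
sum of the coordinates of their lower left corners; hence the monodromy of the crossings of the
vertical and horizontal grid lines can be prescribed independently. -/
theorem exists_staircase_monodromy {G : Type*} [Group G] (R U : G) {x y a b : ℝ}
    (ha : 0 < a) (hb : 0 < b)
    (hxy : ∀ t : ℝ, ¬ ((∃ n : ℤ, x + t * a = n) ∧ ∃ n : ℤ, y + t * b = n)) :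
    ∃ g : ℤ → G, ∀ t : ℝ,
      (∀ n : ℤ, x + t * a = n → g (n + ⌊y + t * b⌋) = R * g (n - 1 + ⌊y + t * b⌋)) ∧
      (∀ n : ℤ, y + t * b = n → g (⌊x + t * a⌋ + n) = U * g (⌊x + t * a⌋ + (n - 1))) := by
  classical
  -- The factor at `k` is `R` exactly when cell `k` is entered through a vertical grid line.
  obtain ⟨g, hg⟩ := exists_int_recursion fun k : ℤ =>
    if ∃ (t : ℝ) (n : ℤ), x + t * a = n ∧ n + ⌊y + t * b⌋ = k then R else U
  refine ⟨g, fun t => ⟨fun n hn => ?_, fun n hn => ?_⟩⟩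
  · rw [hg, if_pos ⟨t, n, hn, rfl⟩]
    congr 2
    ring
  · rw [hg, if_neg]
    · congr 2
      ring
    · rintro ⟨s, m, hm, hk⟩
      -- A vertical crossing at time `s` and a horizontal one at time `t` never enter cells with the
      -- same number: both floors are monotone in time and one of them jumps in between, while `s =
      -- t` would be a lattice point.
      rcases lt_trichotomy s t with h | rfl | h
      · have h1 : x + s * a < x + t * a := by gcongr
        have h2 : y + s * b < n := by rw [← hn]; gcongr
        have h3 : ⌊y + s * b⌋ < n := Int.floor_lt.2 h2
        have h4 : m ≤ ⌊x + t * a⌋ := Int.le_floor.2 (hm ▸ h1.le)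
        omega
      · exact hxy s ⟨⟨m, hm⟩, n, hn⟩
      · have h1 : x + t * a < m := by rw [← hm]; gcongr
        have h2 : y + t * b < y + s * b := by gcongr
        have h3 : ⌊x + t * a⌋ < m := Int.floor_lt.2 h1
        have h4 : n ≤ ⌊y + s * b⌋ := Int.le_floor.2 (hn ▸ h2.le)
        omega

/-! ### Reflected coordinates and construction of geodesics -/

/-- Reflection of the plane that maps the unit square to itself and the direction
`(|v 0|, |v 1|)` to the direction `v`. -/
def reflectTo (v p : Fin 2 → ℝ) : Fin 2 → ℝ :=
  fun i => if 0 < v i then p i else 1 - p i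

theorem reflectTo_add_smul (v p : Fin 2 → ℝ) (h : ℝ) :
    reflectTo v (fun i => p i + h * |v i|) = reflectTo v p + h • v := by
  funext i
  by_cases hv : 0 < v i
  · simp [reflectTo, hv, abs_of_pos hv]
  · simp [reflectTo, hv, abs_of_nonpos (not_lt.1 hv)]
    ring

theorem reflectTo_sub_smul (v p : Fin 2 → ℝ) (h : ℝ) :
    reflectTo v (fun i => p i - h * |v i|) = reflectTo v p - h • v := by
  simpa [sub_eq_add_neg] using reflectTo_add_smul v p (-h)

theorem reflectTo_mem {v p : Fin 2 → ℝ} (hp : ∀ i, p i ∈ Set.Icc (0 : ℝ) 1) :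
    reflectTo v p ∈ Set.Icc (0 : Fin 2 → ℝ) 1 := by
  constructor <;> intro i <;> have := hp i <;> simp only [reflectTo] <;> split_ifs <;>
    simp [this.1, this.2]

/-- The nearest point retraction of the plane onto the unit square. -/
def clampToSquare (p : Fin 2 → ℝ) : UnitSquare :=
  ⟨fun i => max 0 (min 1 (p i)), fun _ => le_max_left _ _,
    fun _ => max_le zero_le_one (min_le_left _ _)⟩

theorem clampToSquare_of_mem {p : Fin 2 → ℝ} (hp : p ∈ Set.Icc (0 : Fin 2 → ℝ) 1) :
    clampToSquare p = ⟨p, hp⟩ := by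
  refine Subtype.ext (funext fun i => ?_)
  have h0 := hp.1 i
  have h1 := hp.2 i
  simp only [Pi.zero_apply, Pi.one_apply] at h0 h1
  simp [clampToSquare, h0, h1]

theorem measurable_clampToSquare : Measurable clampToSquare := by
  refine Measurable.subtype_mk (measurable_pi_lambda _ fun i => ?_)
  fun_prop

theorem measurable_reflectTo (v : Fin 2 → ℝ) : Measurable (reflectTo v) := by
  refine measurable_pi_lambda _ fun i => ?_
  by_cases hv : 0 < v i
  · simp only [reflectTo, hv, if_true]
    fun_prop
  · simp only [reflectTo, hv, if_false]
    fun_prop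

theorem measurePreserving_reflectTo (v : Fin 2 → ℝ) : MeasurePreserving (reflectTo v) := by
  refine measurePreserving_pi (fun _ => volume) (fun _ => volume)
    (f := fun i x => if 0 < v i then x else 1 - x) fun i => ?_
  by_cases hv : 0 < v i
  · simp only [hv, if_true]
    exact MeasurePreserving.id _
  · simp only [hv, if_false]
    exact Measure.measurePreserving_sub_left volume 1

namespace PolysquareSurface

variable {ι : Type*} (P : PolysquareSurface ι)

/-- The point of the square `σ` with reflected coordinates `p`. -/
def pointAt (v : Fin 2 → ℝ) (σ : ι) (p : Fin 2 → ℝ) : P.Point :=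
  P.toPoint σ (clampToSquare (reflectTo v p))

theorem pointAt_of_mem {v p : Fin 2 → ℝ} (σ : ι) (hp : reflectTo v p ∈ Set.Icc (0 : Fin 2 → ℝ) 1) :
    P.pointAt v σ p = P.toPoint σ ⟨reflectTo v p, hp⟩ := by
  rw [pointAt, clampToSquare_of_mem hp]

/-- The square entered when a straight motion with direction `v` crosses a vertical edge. -/
def stepRight (v : Fin 2 → ℝ) : Equiv.Perm ι := if 0 < v 0 then P.right else P.right⁻¹

/-- The square entered when a straight motion with direction `v` crosses a horizontal edge. -/
def stepUp (v : Fin 2 → ℝ) : Equiv.Perm ι := if 0 < v 1 then P.up else P.up⁻¹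

theorem pointAt_stepRight (v : Fin 2 → ℝ) (σ : ι) {p q : Fin 2 → ℝ} (hp : p 0 = 1) (hq : q 0 = 0)
    (h : p 1 = q 1) : P.pointAt v σ p = P.pointAt v (P.stepRight v σ) q := by
  unfold stepRight
  by_cases hv : 0 < v 0
  · rw [if_pos hv]
    exact Quot.sound (Glue.right σ _ _ (by simp [clampToSquare, reflectTo, hv, hp])
      (by simp [clampToSquare, reflectTo, hv, hq]) (by simp [clampToSquare, reflectTo, h]))
  · rw [if_neg hv]
    have := Quot.sound (Glue.right (P := P) (P.right⁻¹ σ) (clampToSquare (reflectTo v q))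
      (clampToSquare (reflectTo v p)) (by simp [clampToSquare, reflectTo, hv, hq])
      (by simp [clampToSquare, reflectTo, hv, hp]) (by simp [clampToSquare, reflectTo, h]))
    rw [← Equiv.Perm.mul_apply, mul_inv_cancel, Equiv.Perm.one_apply] at this
    exact this.symm

theorem pointAt_stepUp (v : Fin 2 → ℝ) (σ : ι) {p q : Fin 2 → ℝ} (hp : p 1 = 1) (hq : q 1 = 0)
    (h : p 0 = q 0) : P.pointAt v σ p = P.pointAt v (P.stepUp v σ) q := by
  unfold stepUp
  by_cases hv : 0 < v 1
  · rw [if_pos hv]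
    exact Quot.sound (Glue.up σ _ _ (by simp [clampToSquare, reflectTo, hv, hp])
      (by simp [clampToSquare, reflectTo, hv, hq]) (by simp [clampToSquare, reflectTo, h]))
  · rw [if_neg hv]
    have := Quot.sound (Glue.up (P := P) (P.up⁻¹ σ) (clampToSquare (reflectTo v q))
      (clampToSquare (reflectTo v p)) (by simp [clampToSquare, reflectTo, hv, hq])
      (by simp [clampToSquare, reflectTo, hv, hp]) (by simp [clampToSquare, reflectTo, h]))
    rw [← Equiv.Perm.mul_apply, mul_inv_cancel, Equiv.Perm.one_apply] at this
    exact this.symm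

/-- A point of the surface is a vertex if it is represented by corners of squares. -/
def IsVertex : P.Point → Prop :=
  Quot.lift (fun s => ∀ i, s.2.1 i = 0 ∨ s.2.1 i = 1) <| by
    rintro _ _ (⟨σ, p, q, hp, hq, h⟩ | ⟨σ, p, q, hp, hq, h⟩) <;>
      simp [Fin.forall_fin_two, hp, hq, h]

theorem isVertex_of_isSingular {x : P.Point} (hx : P.IsSingular x) : P.IsVertex x := by
  obtain ⟨σ, p, hp, -, rfl⟩ := hx
  intro i
  exact Or.inr (congrFun hp i)

theorem not_isSingular_pointAt (v : Fin 2 → ℝ) (σ : ι) {p : Fin 2 → ℝ}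
    (hp : ∀ i, p i ∈ Set.Icc (0 : ℝ) 1) {i : Fin 2} (hi : p i ∈ Set.Ioo (0 : ℝ) 1) :
    ¬ P.IsSingular (P.pointAt v σ p) := by
  intro h
  rw [P.pointAt_of_mem σ (reflectTo_mem hp)] at h
  have hc : reflectTo v p i = 0 ∨ reflectTo v p i = 1 := P.isVertex_of_isSingular h i
  have h0 := hi.1
  have h1 := hi.2
  unfold reflectTo at hc
  split_ifs at hc <;> rcases hc with hc | hc <;> linarith

end PolysquareSurface

theorem exists_pos_forall_mul_lt {u r : Fin 2 → ℝ} (hr : ∀ i, 0 < r i) :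
    ∃ ε > 0, ∀ h ∈ Set.Icc 0 ε, ∀ i, h * |u i| < r i := by
  -- The `+ 1` avoids division by zero and makes the final inequality strict.
  have hpos : ∀ i, 0 < r i / (|u i| + 1) := fun i => div_pos (hr i) (by positivity)
  refine ⟨min (r 0 / (|u 0| + 1)) (r 1 / (|u 1| + 1)), lt_min (hpos 0) (hpos 1),
    fun h hh i => ?_⟩
  have hle : h ≤ r i / (|u i| + 1) := by
    fin_cases i
    · exact hh.2.trans (min_le_left _ _)
    · exact hh.2.trans (min_le_right _ _)
  have : h * (|u i| + 1) ≤ r i := (le_div_iff₀ (by positivity)).1 hle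
  rcases hh.1.eq_or_lt with rfl | h0
  · simpa using hr i
  · linarith

theorem floor_eq_and_fract_eq {q d : ℝ} {n : ℤ} (hd : d ∈ Set.Ico (0 : ℝ) 1) (hq : q = n + d) :
    ⌊q⌋ = n ∧ Int.fract q = d := by
  have h : ⌊q⌋ = n := by
    rw [Int.floor_eq_iff, hq]
    exact ⟨by linarith [hd.1], by linarith [hd.2]⟩
  exact ⟨h, by rw [Int.fract, h, hq]; ring⟩

namespace PolysquareSurface

variable {ι : Type*} (P : PolysquareSurface ι)

/-- Above a line of the plane that avoids the integer lattice there is, through the points of all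
the squares simultaneously, a geodesic of the surface. -/
theorem exists_isGeodesic_family {v p : Fin 2 → ℝ} (hv : ∀ i, v i ≠ 0)
    (hp : ∀ t : ℝ, ¬ ∀ i, ∃ n : ℤ, p i + t * |v i| = n) :
    ∃ g : ℝ → Equiv.Perm ι, ∀ σ, P.IsGeodesic v fun t =>
      P.pointAt v (g t σ) fun i => Int.fract (p i + t * |v i|) := by
  obtain ⟨g, hg⟩ := exists_staircase_monodromy (P.stepRight v) (P.stepUp v)
    (x := p 0) (y := p 1) (abs_pos.2 (hv 0)) (abs_pos.2 (hv 1))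
    fun t ht => hp t (Fin.forall_fin_two.2 ht)
  refine ⟨fun t => g (⌊p 0 + t * |v 0|⌋ + ⌊p 1 + t * |v 1|⌋), fun σ t => ⟨?_, ?_, ?_⟩⟩
  · have ht := hp t
    push Not at ht
    obtain ⟨i, hi⟩ := ht
    refine P.not_isSingular_pointAt v _ (fun i => ⟨Int.fract_nonneg _, (Int.fract_lt_one _).le⟩)
      (i := i) ⟨(Int.fract_nonneg _).lt_of_ne fun h => ?_, Int.fract_lt_one _⟩
    obtain ⟨n, hn⟩ := Int.fract_eq_zero_iff.1 h.symm
    exact hi n hn.symm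
  · obtain ⟨ε, hε, hlt⟩ := exists_pos_forall_mul_lt (u := v)
      (r := fun i => 1 - Int.fract (p i + t * |v i|)) fun i => sub_pos.2 (Int.fract_lt_one _)
    refine ⟨ε, hε, g (⌊p 0 + t * |v 0|⌋ + ⌊p 1 + t * |v 1|⌋) σ,
      reflectTo v fun i => Int.fract (p i + t * |v i|), fun h hh => ?_⟩
    have hd : ∀ i, Int.fract (p i + t * |v i|) + h * |v i| ∈ Set.Ico (0 : ℝ) 1 := fun i =>
      ⟨add_nonneg (Int.fract_nonneg _) (mul_nonneg hh.1 (abs_nonneg _)), by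
        linarith [hlt h hh i]⟩
    have key := fun i => floor_eq_and_fract_eq (q := p i + (t + h) * |v i|) (hd i)
      (n := ⌊p i + t * |v i|⌋) (by linarith [Int.floor_add_fract (p i + t * |v i|)])
    have hmem := reflectTo_mem (v := v) fun i => Set.Ico_subset_Icc_self (hd i)
    have heq := reflectTo_add_smul v (fun i => Int.fract (p i + t * |v i|)) h
    simp only [key, ← heq]
    exact ⟨hmem, P.pointAt_of_mem _ hmem⟩
  -- Looking backwards, the relevant cell is the one just left, so `⌈·⌉ - 1` replaces the floor and
  -- coordinates lie in `(0,1]`.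
  · have hr : ∀ i, p i + t * |v i| - (⌈p i + t * |v i|⌉ - 1) ∈ Set.Ioc (0 : ℝ) 1 := fun i =>
      ⟨by linarith [Int.ceil_lt_add_one (p i + t * |v i|)],
        by linarith [Int.le_ceil (p i + t * |v i|)]⟩
    obtain ⟨ε, hε, hlt⟩ := exists_pos_forall_mul_lt (u := v) fun i => (hr i).1
    refine ⟨ε, hε, g ((⌈p 0 + t * |v 0|⌉ - 1) + (⌈p 1 + t * |v 1|⌉ - 1)) σ,
      reflectTo v fun i => p i + t * |v i| - (⌈p i + t * |v i|⌉ - 1), fun h hh => ?_⟩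
    have hmem := reflectTo_mem (v := v)
      (p := fun i => p i + t * |v i| - (⌈p i + t * |v i|⌉ - 1) - h * |v i|)
      fun i => ⟨by linarith [hlt h hh i],
        by linarith [(hr i).2, mul_nonneg hh.1 (abs_nonneg (v i))]⟩
    have heq := reflectTo_sub_smul v (fun i => p i + t * |v i| - (⌈p i + t * |v i|⌉ - 1)) h
    simp only [← heq]
    refine ⟨hmem, ?_⟩
    rw [← P.pointAt_of_mem _ hmem]
    -- At `h = 0` the curve is recorded in the cell being entered. If an edge is crossed there, the
    -- gluing and the recursion for `g` identify this point with the one in the cell just left.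
    rcases hh.1.eq_or_lt with rfl | h0
    · simp only [sub_zero, zero_mul]
      have hceil : ∀ i, (¬ ∃ n : ℤ, p i + t * |v i| = n) →
          ⌈p i + t * |v i|⌉ - 1 = ⌊p i + t * |v i|⌋ := fun i hi => by
        rw [(Int.ceil_eq_floor_add_one_iff_notMem _).2 fun ⟨n, hn⟩ => hi ⟨n, hn.symm⟩]
        ring
      by_cases hx : ∃ n : ℤ, p 0 + t * |v 0| = n
      · obtain ⟨n, hn⟩ := hx
        have hy : ¬ ∃ n : ℤ, p 1 + t * |v 1| = n := fun hy => hp t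
          (Fin.forall_fin_two.2 ⟨⟨n, hn⟩, hy⟩)
        have hc := hceil 1 hy
        have hg' := (hg t).1 n hn
        rw [hn, Int.floor_intCast, Int.ceil_intCast, hc, hg', Equiv.Perm.mul_apply]
        refine (P.pointAt_stepRight v _ ?_ ?_ ?_).symm
        · simp [hn]
        · simp [hn]
        · rw [← Int.self_sub_floor, ← hc]; push_cast; ring
      · have hc := hceil 0 hx
        by_cases hy : ∃ n : ℤ, p 1 + t * |v 1| = n
        · obtain ⟨n, hn⟩ := hy
          have hg' := (hg t).2 n hn
          rw [hn, Int.floor_intCast, Int.ceil_intCast, hc, hg', Equiv.Perm.mul_apply]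
          refine (P.pointAt_stepUp v _ ?_ ?_ ?_).symm
          · simp [hn]
          · simp [hn]
          · rw [← Int.self_sub_floor, ← hc]; push_cast; ring
        · have hc' := hceil 1 hy
          rw [hc, hc']
          congr 1
          funext i
          have : ⌈p i + t * |v i|⌉ - 1 = ⌊p i + t * |v i|⌋ := by fin_cases i <;> assumption
          rw [← Int.self_sub_floor, ← this]; push_cast; ring
    · have key := fun i => floor_eq_and_fract_eq (q := p i + (t - h) * |v i|)
        (d := p i + t * |v i| - (⌈p i + t * |v i|⌉ - 1) - h * |v i|)
        (n := ⌈p i + t * |v i|⌉ - 1)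
        ⟨by linarith [hlt h hh i],
          by linarith [(hr i).2, mul_pos h0 (abs_pos.2 (hv i))]⟩ (by push_cast; ring)
      simp only [key]

end PolysquareSurface

/-! ### Linear flow on the torus and its eigenfunctions -/

/-- Almost every line with a given direction avoids the integer lattice. -/
theorem ae_line_avoids_lattice (u : Fin 2 → ℝ) :
    ∀ᵐ p : Fin 2 → ℝ, ∀ t : ℝ, ¬ ∀ i, ∃ n : ℤ, p i + t * u i = n := by
  -- The bad points lie on countably many translates of a proper subspace, each of them null.
  have htop : Submodule.span ℝ {u} ≠ ⊤ := fun h => by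
    have h1 := finrank_span_le_card (R := ℝ) ({u} : Set (Fin 2 → ℝ))
    rw [h, finrank_top, Module.finrank_fin_fun] at h1
    simp at h1
  have hnull := Measure.addHaar_submodule (volume : Measure (Fin 2 → ℝ)) _ htop
  have hall : ∀ᵐ p : Fin 2 → ℝ, ∀ m : Fin 2 → ℤ,
      p + (fun i => -(m i : ℝ)) ∉ (Submodule.span ℝ {u} : Set (Fin 2 → ℝ)) := by
    refine ae_all_iff.2 fun m => ?_
    have := measure_preimage_add_right (volume : Measure (Fin 2 → ℝ)) (fun i => -(m i : ℝ))
      (Submodule.span ℝ {u} : Set (Fin 2 → ℝ))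
    exact measure_eq_zero_iff_ae_notMem.1 (this.trans hnull)
  filter_upwards [hall] with p hp t ht
  choose m hm using ht
  refine hp m (Submodule.mem_span_singleton.2 ⟨-t, funext fun i => ?_⟩)
  have := hm i
  simp only [Pi.smul_apply, Pi.add_apply, smul_eq_mul]
  linarith

theorem mFourier_add_apply (m : Fin 2 → ℤ) (a b : UnitAddTorus (Fin 2)) :
    UnitAddTorus.mFourier m (a + b) = UnitAddTorus.mFourier m a * UnitAddTorus.mFourier m b := by
  simp only [UnitAddTorus.mFourier, ContinuousMap.coe_mk, Pi.add_apply, ← Finset.prod_mul_distrib]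
  exact Finset.prod_congr rfl fun i _ => by simp [fourier_apply, smul_add, AddCircle.toCircle_add]

theorem mFourier_coe_apply (m : Fin 2 → ℤ) (p : Fin 2 → ℝ) :
    UnitAddTorus.mFourier m (fun i => ((p i : ℝ) : UnitAddCircle)) =
      Complex.exp (2 * Real.pi * Complex.I * (∑ i, m i * p i : ℝ)) := by
  simp only [UnitAddTorus.mFourier, ContinuousMap.coe_mk, fourier_coe_apply, ← Complex.exp_sum]
  congr 1
  push_cast
  rw [Finset.mul_sum]
  exact Finset.sum_congr rfl fun i _ => by ring

/-- The linear flow on the torus has no bounded eigenfunction outside its group of frequencies. -/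
theorem ae_eq_zero_of_torus_eigenfunction {F : UnitAddTorus (Fin 2) → ℂ} (hF : Measurable F)
    {C : ℝ} (hC : ∀ a, ‖F a‖ ≤ C) {u : Fin 2 → ℝ} {θ : ℝ}
    (hθ : ∀ m : Fin 2 → ℤ, ∑ i, m i * u i ≠ θ)
    (heig : ∀ t : ℝ, ∀ᵐ a ∂torusMeasure, F (a + fun i => ((t * u i : ℝ) : UnitAddCircle)) =
      Complex.exp (2 * Real.pi * Complex.I * (t * θ : ℝ)) * F a) :
    F =ᵐ[torusMeasure] 0 := by
  have hmem : MemLp F 2 torusMeasure :=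
    MemLp.of_bound hF.aestronglyMeasurable C (Filter.Eventually.of_forall hC)
  refine ae_eq_zero_of_mFourier_integral_eq_zero hmem fun m => ?_
  have hβ : θ - ∑ i, m i * u i ≠ 0 := sub_ne_zero.2 (hθ m).symm
  -- For this time, translation by `t • u` multiplies the integrand by `e(1/2) = -1`, while Haar
  -- measure preserves the integral.
  obtain ⟨t, ht⟩ : ∃ t : ℝ, t * (θ - ∑ i, m i * u i) = 1 / 2 :=
    ⟨1 / 2 / (θ - ∑ i, m i * u i), div_mul_cancel₀ _ hβ⟩
  have hinv := integral_add_right_eq_self (μ := torusMeasure)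
    (fun a => UnitAddTorus.mFourier (-m) a * F a) (fun i => ((t * u i : ℝ) : UnitAddCircle))
  have hneg : ∫ a, UnitAddTorus.mFourier (-m) (a + fun i => ((t * u i : ℝ) : UnitAddCircle)) *
      F (a + fun i => ((t * u i : ℝ) : UnitAddCircle)) ∂torusMeasure =
      -∫ a, UnitAddTorus.mFourier (-m) a * F a ∂torusMeasure := by
    rw [← integral_neg]
    refine integral_congr_ae ?_
    filter_upwards [heig t] with a ha
    have hexp : Complex.exp (2 * Real.pi * Complex.I * (∑ i, (-m) i * (t * u i) : ℝ)) *
        Complex.exp (2 * Real.pi * Complex.I * (t * θ : ℝ)) = -1 := by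
      rw [← Complex.exp_add, ← Complex.exp_pi_mul_I, ← mul_add, ← Complex.ofReal_add]
      have : (∑ i, ((-m) i : ℤ) * (t * u i) : ℝ) + t * θ = 1 / 2 := by
        rw [← ht]
        simp only [Fin.sum_univ_two, Pi.neg_apply, Int.cast_neg]
        ring
      rw [this]
      congr 1
      push_cast
      ring
    rw [ha, mFourier_add_apply, mFourier_coe_apply]
    linear_combination (UnitAddTorus.mFourier (-m) a * F a) * hexp
  exact self_eq_neg.1 (hinv.symm.trans hneg)

theorem fourierCoeff_comp_add_right (f : UnitAddCircle → ℂ) (n : ℤ) (s : ℝ) :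
    fourierCoeff f n = Complex.exp (2 * Real.pi * Complex.I * (-n * s : ℝ)) *
      fourierCoeff (fun y => f (y + (s : UnitAddCircle))) n := by
  have hinv := integral_add_right_eq_self (μ := AddCircle.haarAddCircle)
    (fun y : UnitAddCircle => fourier (-n) y • f y) (s : UnitAddCircle)
  rw [fourierCoeff, ← hinv, fourierCoeff, ← integral_const_mul]
  refine integral_congr_ae (Filter.Eventually.of_forall fun y => ?_)
  have hs : fourier (-n) (s : UnitAddCircle) =
      Complex.exp (2 * Real.pi * Complex.I * (-n * s : ℝ)) := by
    rw [fourier_coe_apply]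
    congr 1
    push_cast
    ring
  have hadd : fourier (-n) (y + (s : UnitAddCircle)) =
      fourier (-n) y * fourier (-n) (s : UnitAddCircle) := by
    simp [fourier_apply, smul_add, AddCircle.toCircle_add, -neg_smul]
  simp only [hadd, hs, smul_eq_mul]
  ring

/-! ### Rational independence -/

/-- The rational span of `v 0` and `v 1` is countable, so some real `w` lies outside it. -/
theorem exists_isKroneckerDirection (v : Fin 2 → ℝ) (hv : IsKroneckerDirection v) :
    ∃ w : ℝ, IsKroneckerDirection ![v 0, v 1, w] := by
  have hcount : (Set.range fun c : ℚ × ℚ => (c.1 : ℝ) * v 0 + c.2 * v 1).Countable :=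
    Set.countable_range _
  obtain ⟨w, hw⟩ : ∃ w, w ∉ Set.range fun c : ℚ × ℚ => (c.1 : ℝ) * v 0 + c.2 * v 1 := by
    by_contra! h
    exact Cardinal.not_countable_real (hcount.mono fun w _ => h w)
  refine ⟨w, Fintype.linearIndependent_iff.2 fun g hg => ?_⟩
  simp only [Fin.sum_univ_three, Rat.smul_def] at hg
  simp only [Matrix.cons_val] at hg
  have h2 : g 2 = 0 := by
    by_contra h
    have h' : (g 2 : ℝ) ≠ 0 := by exact_mod_cast h
    refine hw ⟨(-(g 0 / g 2), -(g 1 / g 2)), ?_⟩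
    push_cast
    field_simp
    linarith
  have h01 := Fintype.linearIndependent_iff.1 hv ![g 0, g 1] (by
    simpa [Fin.sum_univ_two, Rat.smul_def, h2] using hg)
  intro i
  fin_cases i
  · exact h01 0
  · exact h01 1
  · exact h2

/-- The signs relating `|v i|` to `v i` are absorbed into the integer coefficients. -/
theorem IsKroneckerDirection.sum_abs_ne {v : Fin 2 → ℝ} {w : ℝ}
    (hw : IsKroneckerDirection ![v 0, v 1, w]) (m : Fin 2 → ℤ) {n : ℤ} (hn : n ≠ 0) :
    ∑ i, m i * |v i| ≠ n * w := by
  intro h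
  have hs : ∀ i, ∃ e : ℤ, |v i| = e * v i := fun i => by
    rcases abs_choice (v i) with h | h
    · exact ⟨1, by simp [h]⟩
    · exact ⟨-1, by simp [h]⟩
  choose e he using hs
  have := Fintype.linearIndependent_iff.1 hw ![(m 0 * e 0 : ℤ), (m 1 * e 1 : ℤ), (-n : ℤ)] (by
    simp only [Fin.sum_univ_two, he] at h
    simp only [Fin.sum_univ_three, Rat.smul_def, Matrix.cons_val]
    push_cast
    linarith) 2
  simp [hn] at this

/-! ### Eigenfunctions on the surface -/

namespace PolysquareSurface

variable {ι : Type*} (P : PolysquareSurface ι)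

theorem measurable_toPoint (σ : ι) : Measurable (P.toPoint σ) := by
  have h1 : Measurable (Quot.mk P.Glue) := fun s hs => hs
  have h2 : Measurable (Sigma.mk (β := fun _ : ι => UnitSquare) σ) :=
    fun s hs => MeasurableSpace.measurableSet_iInf.1 hs σ
  exact h1.comp h2

theorem measurable_pointAt (v : Fin 2 → ℝ) (σ : ι) : Measurable (P.pointAt v σ) :=
  (P.measurable_toPoint σ).comp (measurable_clampToSquare.comp (measurable_reflectTo v))

theorem isGeodesic3_of_isGeodesic {v : Fin 2 → ℝ} {L : ℝ → P.Point} (hL : P.IsGeodesic v L) (w : ℝ)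
    (y : UnitAddCircle) :
    P.IsGeodesic3 ![v 0, v 1, w] fun t => (L t, y + ((t * w : ℝ) : UnitAddCircle)) := by
  refine ⟨?_, fun t => by simp⟩
  have : ![(![v 0, v 1, w] : Fin 3 → ℝ) 0, (![v 0, v 1, w] : Fin 3 → ℝ) 1] = v := by
    funext i
    fin_cases i <;> rfl
  rwa [this]

instance : IsFiniteMeasure (volume.comap Subtype.val : Measure UnitSquare) := by
  refine ⟨?_⟩
  rw [comap_subtype_coe_apply measurableSet_Icc]
  rw [Set.image_univ, Subtype.range_coe]
  exact (isCompact_Icc (a := (0 : Fin 2 → ℝ)) (b := 1)).measure_lt_top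

variable [Fintype ι]

instance : IsFiniteMeasure P.area := by
  unfold area
  infer_instance

theorem ae_pointAt {p : P.Point → Prop} (hp : ∀ᵐ x ∂P.area, p x) (v : Fin 2 → ℝ) (σ : ι) :
    ∀ᵐ q : Fin 2 → ℝ, (∀ i, q i ∈ Set.Icc (0 : ℝ) 1) → p (P.pointAt v σ q) := by
  have hσ : ∀ᵐ x ∂Measure.map (P.toPoint σ) (Measure.comap Subtype.val volume), p x := by
    refine ae_mono ?_ hp
    exact Finset.single_le_sum (f := fun σ : ι =>
      Measure.map (P.toPoint σ) (Measure.comap Subtype.val volume)) (fun _ _ => bot_le)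
      (Finset.mem_univ σ)
  have h1 := ae_of_ae_map (P.measurable_toPoint σ).aemeasurable hσ
  have h2 : ∀ᵐ q ∂(volume : Measure (Fin 2 → ℝ)).restrict (Set.Icc 0 1),
      p (P.toPoint σ (clampToSquare q)) := by
    rw [ae_restrict_iff_subtype measurableSet_Icc]
    filter_upwards [h1] with r hr
    rwa [clampToSquare_of_mem r.2]
  rw [ae_restrict_iff' measurableSet_Icc] at h2
  filter_upwards [(measurePreserving_reflectTo v).quasiMeasurePreserving.ae h2] with q hq hmem
  exact hq (reflectTo_mem hmem)

/-- A bounded measurable function on the surface that is multiplied by a character of frequency `θ`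
along every geodesic cannot be almost everywhere nonzero, unless a multiple of `θ` is a frequency of
the linear flow on the torus. -/
theorem not_ae_ne_zero_of_eigenfunction {v : Fin 2 → ℝ} (hv : ∀ i, v i ≠ 0)
    {f : P.Point → ℂ} (hf : Measurable f) {C : ℝ} (hC : ∀ x, ‖f x‖ ≤ C) {θ : ℝ}
    (hθ : ∀ m : Fin 2 → ℤ, ∑ i, m i * |v i| ≠ Fintype.card ι * θ)
    (heig : ∀ L, P.IsGeodesic v L → ∀ t : ℝ,
      f (L t) = Complex.exp (2 * Real.pi * Complex.I * (t * θ : ℝ)) * f (L 0)) :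
    ¬ ∀ᵐ x ∂P.area, f x ≠ 0 := by
  intro hne
  set F : UnitAddTorus (Fin 2) → ℂ := fun a => ∏ σ, f (P.pointAt v σ (torusRep a)) with hFdef
  have hF : Measurable F := Finset.measurable_fun_prod _ fun σ _ =>
    hf.comp ((P.measurable_pointAt v σ).comp measurable_torusRep)
  have hFC : ∀ a, ‖F a‖ ≤ C ^ Fintype.card ι := fun a => by
    rw [hFdef, norm_prod]
    exact (Finset.prod_le_prod (fun _ _ => norm_nonneg _) fun σ _ => hC _).trans_eq (by simp)
  have hrep : ∀ (a : UnitAddTorus (Fin 2)) (t : ℝ),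
      torusRep (a + fun i => ((t * |v i| : ℝ) : UnitAddCircle)) =
        fun i => Int.fract (torusRep a i + t * |v i|) := fun a t => by
    rw [← torusRep_coe]
    congr 1
    funext i
    simp [coe_torusRep]
  have hzero := ae_eq_zero_of_torus_eigenfunction hF hFC (u := fun i => |v i|) hθ fun t => by
    filter_upwards [ae_torusRep (ae_line_avoids_lattice fun i => |v i|)] with a ha
    obtain ⟨g, hg⟩ := P.exists_isGeodesic_family hv ha
    have hshift : ∀ s : ℝ, F (a + fun i => ((s * |v i| : ℝ) : UnitAddCircle)) =
        ∏ σ, f (P.pointAt v (g s σ) fun i => Int.fract (torusRep a i + s * |v i|)) := fun s => by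
      rw [hFdef]
      simp only [hrep]
      -- At time `s` the geodesics started in all the squares again occupy each square once, so the
      -- fibre product can be reindexed by `g s`.
      exact (Equiv.prod_comp (g s) fun σ => f (P.pointAt v σ fun i =>
        Int.fract (torusRep a i + s * |v i|))).symm
    have h0 : F a = ∏ σ, f (P.pointAt v (g 0 σ) fun i => Int.fract (torusRep a i + 0 * |v i|)) := by
      rw [← hshift 0]
      congr 1
      funext i
      simp
    rw [hshift t, h0, Finset.prod_congr rfl fun σ _ => heig _ (hg σ) t, Finset.prod_mul_distrib,
      Finset.prod_const, Finset.card_univ, ← Complex.exp_nat_mul]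
    congr 2
    push_cast
    ring
  have hF0 : ∀ᵐ a ∂torusMeasure, F a ≠ 0 := by
    have := ae_torusRep (Filter.eventually_all.2 fun σ => P.ae_pointAt hne v σ)
    filter_upwards [this] with a ha
    exact Finset.prod_ne_zero_iff.2 fun σ _ =>
      ha σ fun i => Set.Ico_subset_Icc_self (torusRep_mem a i)
  obtain ⟨a, h1, h2⟩ := (hzero.and hF0).exists
  exact h2 h1

/-! ### Transfer of ergodicity between surface and product -/

theorem geodesicFlowErgodic_of_geodesicFlowErgodic3 {v : Fin 2 → ℝ} {w : ℝ}
    (h : P.GeodesicFlowErgodic3 ![v 0, v 1, w]) : P.GeodesicFlowErgodic v := by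
  intro A hA hinv
  have key := h (Prod.fst ⁻¹' A) (measurable_fst hA) fun L hL s t => by
    refine hinv (fun t => (L t).1) ?_ s t
    have := hL.1
    have hvv : ![(![v 0, v 1, w] : Fin 3 → ℝ) 0, (![v 0, v 1, w] : Fin 3 → ℝ) 1] = v := by
      funext i
      fin_cases i <;> rfl
    rwa [hvv] at this
  have hprod : ∀ B : Set P.Point, P.volume3 (Prod.fst ⁻¹' B) = P.area B := fun B => by
    rw [← Set.prod_univ, volume3, Measure.prod_prod, UnitAddCircle.measure_univ, mul_one]
  rwa [← Set.preimage_compl, hprod, hprod] at key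

theorem geodesicFlowErgodic3_of_geodesicFlowErgodic {v : Fin 2 → ℝ} {w : ℝ}
    (hw : IsKroneckerDirection ![v 0, v 1, w]) (h : P.GeodesicFlowErgodic v) :
    P.GeodesicFlowErgodic3 ![v 0, v 1, w] := by
  intro A hA hinv
  rcases isEmpty_or_nonempty ι with hι | hι
  · left
    have : P.area = 0 := by simp [area]
    simp [volume3, this]
  have hv : ∀ i, v i ≠ 0 := by
    intro i
    fin_cases i
    · exact hw.ne_zero 0
    · exact hw.ne_zero 1
  have hflow : ∀ L, P.IsGeodesic v L → ∀ (t : ℝ) (y : UnitAddCircle),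
      (L t, y + ((t * w : ℝ) : UnitAddCircle)) ∈ A ↔ (L 0, y) ∈ A := fun L hL t y => by
    simpa using hinv _ (P.isGeodesic3_of_isGeodesic hL w y) t 0
  set φ : P.Point → UnitAddCircle → ℂ := fun x y => A.indicator (fun _ => 1) (x, y) with hφ
  have hφm : Measurable (Function.uncurry φ) := measurable_const.indicator hA
  have hφ1 : ∀ x y, ‖φ x y‖ ≤ 1 := fun x y => by
    by_cases hxy : (x, y) ∈ A <;> simp [hφ, hxy]
  have hφflow : ∀ L, P.IsGeodesic v L → ∀ (t : ℝ),
      (fun y => φ (L t) (y + ((t * w : ℝ) : UnitAddCircle))) = φ (L 0) := fun L hL t => by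
    funext y
    by_cases hy : (L 0, y) ∈ A
    · simp [hφ, hy, (hflow L hL t y).2 hy]
    · simp [hφ, hy, (hflow L hL t y).not.2 hy]
  have hcoeff : ∀ n : ℤ, n ≠ 0 → ∀ᵐ x ∂P.area, fourierCoeff (φ x) n = 0 := fun n hn => by
    have hmeas : Measurable fun x => fourierCoeff (φ x) n := by
      have : Measurable (Function.uncurry fun x y => fourier (-n) y • φ x y) :=
        ((fourier (-n)).continuous.measurable.comp measurable_snd).mul hφm
      exact this.stronglyMeasurable.integral_prod_right.measurable
    have heig : ∀ L, P.IsGeodesic v L → ∀ t : ℝ, fourierCoeff (φ (L t)) n =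
        Complex.exp (2 * Real.pi * Complex.I * (t * (-n * w) : ℝ)) * fourierCoeff (φ (L 0)) n :=
      fun L hL t => by
        rw [fourierCoeff_comp_add_right _ n (t * w), hφflow L hL t]
        congr 4
        ring
    have hbound : ∀ x, ‖fourierCoeff (φ x) n‖ ≤ 1 := fun x => by
      refine (norm_integral_le_of_norm_le_const (C := 1)
        (Filter.Eventually.of_forall fun y => ?_)).trans (by simp)
      rw [norm_smul, fourier_apply, Circle.norm_coe, one_mul]
      exact hφ1 x y
    have hzero : ∀ L, P.IsGeodesic v L → ∀ t : ℝ,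
        fourierCoeff (φ (L t)) n = 0 ↔ fourierCoeff (φ (L 0)) n = 0 := fun L hL t => by
      rw [heig L hL t]
      simp
    rcases h {x | fourierCoeff (φ x) n = 0} (hmeas (measurableSet_singleton 0)) fun L hL s t =>
      (hzero L hL s).trans (hzero L hL t).symm with h0 | h0
    · refine absurd (measure_eq_zero_iff_ae_notMem.1 h0)
        (P.not_ae_ne_zero_of_eigenfunction hv hmeas hbound (θ := -n * w) (fun m => ?_) heig)
      -- The fibre product has frequency `card ι * (-n * w)`; its integer factor is nonzero because
      -- there is at least one square.
      have := hw.sum_abs_ne m (n := -(Fintype.card ι * n)) (by simp [hn])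
      push_cast at this
      convert this using 1
      ring
    · exact h0
  have hsection : ∀ᵐ x ∂P.area,
      volume (Prod.mk x ⁻¹' A) = 0 ∨ volume (Prod.mk x ⁻¹' Aᶜ) = 0 := by
    have hall : ∀ᵐ x ∂P.area, ∀ n : ℤ, n ≠ 0 → fourierCoeff (φ x) n = 0 :=
      ae_all_iff.2 fun n => by
        by_cases hn : n = 0
        · simp [hn]
        · filter_upwards [hcoeff n hn] with x hx _ using hx
    filter_upwards [hall] with x hx
    have hmem : MemLp (φ x) 2 AddCircle.haarAddCircle :=
      MemLp.of_bound (hφm.comp measurable_prodMk_left).aestronglyMeasurable 1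
        (Filter.Eventually.of_forall (hφ1 x))
    obtain ⟨c, hc⟩ := ae_eq_const_of_fourierCoeff_eq_zero hmem hx
    rw [← unitAddCircle_volume_eq_haarAddCircle] at hc
    -- An indicator that is a.e. equal to `c` is a.e. `1` if `c = 1`, and otherwise takes the value
    -- `1` almost nowhere.
    by_cases hc1 : c = 1
    · right
      refine measure_eq_zero_iff_ae_notMem.2 ?_
      filter_upwards [hc] with y hy hyA
      have : (x, y) ∉ A := hyA
      simp [hφ, this, hc1] at hy
    · left
      refine measure_eq_zero_iff_ae_notMem.2 ?_
      filter_upwards [hc] with y hy hyA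
      have : (x, y) ∈ A := hyA
      simp only [hφ, this, Set.indicator_of_mem] at hy
      exact hc1 hy.symm
  have hvol : ∀ L, P.IsGeodesic v L → ∀ t : ℝ,
      volume (Prod.mk (L t) ⁻¹' A) = volume (Prod.mk (L 0) ⁻¹' A) := fun L hL t => by
    rw [← measure_preimage_add_right volume ((t * w : ℝ) : UnitAddCircle)]
    congr 1
    ext y
    exact hflow L hL t y
  rcases h {x | volume (Prod.mk x ⁻¹' A) = 0}
    (measurable_measure_prodMk_left hA (measurableSet_singleton 0)) fun L hL s t => by
      simp only [Set.mem_ofPred_eq, hvol L hL s, hvol L hL t] with h0 | h0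
  · right
    refine Measure.measure_prod_null_of_ae_null hA.compl ?_
    filter_upwards [hsection, measure_eq_zero_iff_ae_notMem.1 h0] with x hx hx0
    exact hx.resolve_left hx0
  · left
    exact Measure.measure_prod_null_of_ae_null hA h0

end PolysquareSurface

end

theorem theorem7 {ι : Type*} [Fintype ι] (P : PolysquareSurface ι) (v : Fin 2 → ℝ)
    (hv : IsKroneckerDirection v) :
    P.GeodesicFlowErgodic v ↔
      ∀ w : ℝ, IsKroneckerDirection ![v 0, v 1, w] → P.GeodesicFlowErgodic3 ![v 0, v 1, w] := by
  refine ⟨fun h w hw => P.geodesicFlowErgodic3_of_geodesicFlowErgodic hw h, fun h => ?_⟩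
  obtain ⟨w, hw⟩ := exists_isKroneckerDirection v hv
  exact P.geodesicFlowErgodic_of_geodesicFlowErgodic3 (h w hw)
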